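/- Let $X=(X_t)_{t\ge 0}$ be a multidimensional diffusion on $\mathbb{R}^d$, i.e. a homogeneous nonterminating strong Markov process with continuous trajectories and the Feller property, with laws $P_x$ ($X_0=x$ $P_x$-a.s.). Let $\mathbb{F}=(\mathcal{F}_t)$ be its augmented filtration: $\mathcal{F}_t=\bigcap_\nu \mathcal{F}_t^\nu$, where $\mathcal{F}_t^\nu$ is the completion of $\sigma(X_s, s\le t)$ by the $P_\nu$-null sets and $\nu$ ranges over all initial distributions. For a Borel set $S\subseteq\mathbb{R}^d$ put $h_S=\inf\{t\ge 0: X_t\in S\}$ ($\inf\emptyset=\infty$). Let $r>0$, let $G_r(x,H)=\int_0^\infty e^{-rs}P_x(X_s\in H)\,ds$ be the $r$-Green measure, and let $\lambda$ denote Lebesgue measure on $[0,\infty)$. Let $g:\mathbb{R}^d\to[0,\infty)$ be continuous and let $V(x)=\sup_\tau E_x\big[e^{-r\tau}g(X_\tau)\big]$, the supremum being over all $\mathbb{F}$-stopping times $\tau$, where $e^{-r\tau}g(X_\tau):=\limsup_{t\to\infty}e^{-rt}g(X_t)$ on $\{\tau=\infty\}$. Let $\mathcal{S}=\{x: V(x)=g(x)\}$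 be the stopping set. Assume that there is a continuous $f:\mathbb{R}^d\to\mathbb{R}$, integrable with respect to $G_r(x,\cdot)$ for every $x$, such that for all $x\in\mathbb{R}^d$ $$g(x)=\int_{\mathbb{R}^d} f(y)\,G_r(x,dy)\quad\text{and}\quad V(x)=\int_{\mathcal{S}} f(y)\,G_r(x,dy)$$ (in particular $V$ is finite). Let $\mathbb{U}$ be a class of nonempty closed subsets of $\mathbb{R}^d$ with $\mathcal{S}\in\mathbb{U}$ such that (a) $f(y)>0$ for all $U\in\mathbb{U}$ and $y\in U$; (b) for all $U,U'\in\mathbb{U}$: (i) if $P_x\big(\lambda(\{t\le h_{U^c}: X_t\notin U'\})=0\big)=1$ for all $x\in U\cap U'$, then $U\subseteq U'$; (ii) if $P_x\big(\lambda(\{t\le h_{U}: X_t\in U'\})=0\big)=1$ for all $x\in U^c$, then $U'\subseteq U$. Then the hitting time $h_{\mathcal{S}}$ is an optimal stopping time, i.e. $V(x)=E_x\big[e^{-rh_{\mathcal{S}}}g(X_{h_{\mathcal{S}}})\big]$ for all $x$, and $U=\mathcal{S}$ is the unique set $U\in\mathbb{U}$ that satisfies $$\int_{U^c} f(y)\,G_r(x,dy)=0\quad\text{for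 all } x\in\partial U.$$ -/

import Mathlib

open MeasureTheory ProbabilityTheory Filter Set Topology
open scoped NNReal ENNReal ZeroAtInfty

/-- Lebesgue measure on the time axis `[0, ∞)`. -/
noncomputable def timeMeasure : Measure ℝ≥0 :=
  (volume : Measure ℝ).comap ((↑) : ℝ≥0 → ℝ)

theorem lintegral_timeMeasure (F : ℝ → ℝ≥0∞) :
    ∫⁻ t : ℝ≥0, F t ∂timeMeasure = ∫⁻ t in Ici (0 : ℝ), F t :=
  lintegral_subtype_comap (measurableSet_Ici (a := (0 : ℝ))) F

/-- A nonterminating process with continuous trajectories in `ℝ^d`, together with its family of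
laws `P_x` (depending measurably on the starting point `x`), where `X_0 = x` holds
`P_x`-almost surely. -/
structure ContinuousFamily (d : ℕ) (Ω : Type*) [MeasurableSpace Ω] where
  X : ℝ≥0 → Ω → EuclideanSpace ℝ (Fin d)
  P : Kernel (EuclideanSpace ℝ (Fin d)) Ω
  isMarkovKernel : IsMarkovKernel P
  measurable_X : ∀ t, Measurable (X t)
  continuous_X : ∀ ω, Continuous fun t => X t ω
  start : ∀ x, ∀ᵐ ω ∂P x, X 0 ω = x

namespace ContinuousFamily

variable {d : ℕ} {Ω : Type*} [mΩ : MeasurableSpace Ω]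

instance (D : ContinuousFamily d Ω) : IsMarkovKernel D.P := D.isMarkovKernel

/-- The law `P_ν = ∫ P_x ν(dx)` of the process with initial distribution `ν`. -/
noncomputable def lawFrom (D : ContinuousFamily d Ω)
    (ν : ProbabilityMeasure (EuclideanSpace ℝ (Fin d))) : Measure Ω :=
  (ν : Measure (EuclideanSpace ℝ (Fin d))).bind D.P

/-- The raw filtration `σ(X_s, s ≤ t)` generated by the process. -/
noncomputable def rawFiltration (D : ContinuousFamily d Ω) : Filtration ℝ≥0 mΩ :=
  Filtration.natural D.X fun t => (D.measurable_X t).stronglyMeasurable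

/-- The sets that are measurable up to a `P_ν`-null set, for every initial distribution `ν`. -/
@[reducible] noncomputable def completedSpace (D : ContinuousFamily d Ω) : MeasurableSpace Ω :=
  ⨅ ν, eventuallyMeasurableSpace mΩ (ae (D.lawFrom ν))

/-- The augmented filtration `F_t = ⋂_ν F_t^ν`, where `F_t^ν` is the `σ`-algebra
`σ(X_s, s ≤ t)` completed by all `P_ν`-null sets and `ν` ranges over all initial distributions. -/
noncomputable def filtration (D : ContinuousFamily d Ω) : Filtration ℝ≥0 D.completedSpace where
  seq t := ⨅ ν, eventuallyMeasurableSpace (D.rawFiltration t) (ae (D.lawFrom ν))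
  mono' s t hst := iInf_mono fun ν A hA => by
    obtain ⟨B, hB, hAB⟩ := hA
    exact ⟨B, D.rawFiltration.mono hst B hB, hAB⟩
  le' t := iInf_mono fun ν A hA => by
    obtain ⟨B, hB, hAB⟩ := hA
    exact ⟨B, D.rawFiltration.le t B hB, hAB⟩

/-- The hitting time `h_S = inf {t ≥ 0 : X_t ∈ S}`, with value `⊤` if the set is empty. -/
noncomputable def hit (D : ContinuousFamily d Ω) (S : Set (EuclideanSpace ℝ (Fin d))) :
    Ω → WithTop ℝ≥0 :=
  hittingAfter D.X S 0

/-- A multidimensional diffusion: a homogeneous nonterminating strong Markov process with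
continuous trajectories that satisfies the Feller property. -/
structure IsDiffusion (D : ContinuousFamily d Ω) : Prop where
  /-- The transition operators map `C₀(ℝ^d)` into itself. -/
  feller : ∀ (t : ℝ≥0) (φ : C₀(EuclideanSpace ℝ (Fin d), ℝ)),
    ∃ ψ : C₀(EuclideanSpace ℝ (Fin d), ℝ), ∀ x, ψ x = ∫ ω, φ (D.X t ω) ∂D.P x
  /-- The transition operators converge to the identity pointwise on `C₀(ℝ^d)`. -/
  feller_zero : ∀ (φ : C₀(EuclideanSpace ℝ (Fin d), ℝ)) (x : EuclideanSpace ℝ (Fin d)),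
    Tendsto (fun t : ℝ≥0 => ∫ ω, φ (D.X t ω) ∂D.P x) (𝓝[>] 0) (𝓝 (φ x))
  /-- The strong Markov property at every stopping time `τ`: on `{τ < ∞}`,
  `P_x (X_{τ+t} ∈ B | F_τ) = P_{X_τ} (X_t ∈ B)`. -/
  strong_markov : ∀ (τ : Ω → WithTop ℝ≥0) (hτ : IsStoppingTime D.filtration τ)
    (x : EuclideanSpace ℝ (Fin d)) (A : Set Ω), MeasurableSet[hτ.measurableSpace] A →
    ∀ (t : ℝ≥0) (B : Set (EuclideanSpace ℝ (Fin d))), MeasurableSet B →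
      D.P x (A ∩ {ω | τ ω ≠ ⊤ ∧ D.X ((τ ω).untopA + t) ω ∈ B}) =
        ∫⁻ ω in A ∩ {ω | τ ω ≠ ⊤}, D.P (stoppedValue D.X τ ω) {ω' | D.X t ω' ∈ B} ∂D.P x

/-- The `r`-Green measure `G_r(x, ·)`; see `green_apply` for its value on a set. -/
noncomputable def green (D : ContinuousFamily d Ω) (r : ℝ) (x : EuclideanSpace ℝ (Fin d)) :
    Measure (EuclideanSpace ℝ (Fin d)) :=
  ((timeMeasure.withDensity fun s => ENNReal.ofReal (Real.exp (-r * s))).prod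
    (D.P x)).map fun p => D.X p.1 p.2

theorem measurable_uncurry (D : ContinuousFamily d Ω) :
    Measurable fun p : ℝ≥0 × Ω => D.X p.1 p.2 :=
  measurable_uncurry_of_continuous_of_measurable (u := D.X) D.continuous_X D.measurable_X

/-- `G_r(x, H) = ∫_0^∞ e^{-rs} P_x(X_s ∈ H) ds`. -/
theorem green_apply (D : ContinuousFamily d Ω) (r : ℝ) (x : EuclideanSpace ℝ (Fin d))
    {H : Set (EuclideanSpace ℝ (Fin d))} (hH : MeasurableSet H) :
    D.green r x H = ∫⁻ s in Ici (0 : ℝ),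
      ENNReal.ofReal (Real.exp (-r * s)) * D.P x {ω | D.X s.toNNReal ω ∈ H} := by
  have hm := D.measurable_uncurry hH
  rw [green, Measure.map_apply D.measurable_uncurry hH, Measure.prod_apply hm,
    lintegral_withDensity_eq_lintegral_mul _ (by fun_prop) (measurable_measure_prodMk_left hm),
    ← lintegral_timeMeasure]
  simp only [Real.toNNReal_coe]
  rfl

/-- The discounted reward `e^{-rτ} g(X_τ)`, understood as `limsup_{t → ∞} e^{-rt} g(X_t)` on
`{τ = ∞}`. It takes values in `[0, ∞]`; the reward `g` is meant to be nonnegative. -/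
noncomputable def payoff (D : ContinuousFamily d Ω) (r : ℝ) (g : EuclideanSpace ℝ (Fin d) → ℝ)
    (τ : Ω → WithTop ℝ≥0) (ω : Ω) : ℝ≥0∞ :=
  match τ ω with
  | ⊤ => limsup (fun t : ℝ≥0 => ENNReal.ofReal (Real.exp (-r * t) * g (D.X t ω))) atTop
  | (t : ℝ≥0) => ENNReal.ofReal (Real.exp (-r * t) * g (D.X t ω))

/-- The value function `V(x) = sup_τ E_x[e^{-rτ} g(X_τ)]`, the supremum being over all stopping
times. -/
noncomputable def value (D : ContinuousFamily d Ω) (r : ℝ) (g : EuclideanSpace ℝ (Fin d) → ℝ)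
    (x : EuclideanSpace ℝ (Fin d)) : ℝ≥0∞ :=
  ⨆ (τ : Ω → WithTop ℝ≥0) (_ : IsStoppingTime D.filtration τ), ∫⁻ ω, D.payoff r g τ ω ∂D.P x

/-- The stopping set `{x : V(x) = g(x)}`. -/
def stoppingSet (D : ContinuousFamily d Ω) (r : ℝ) (g : EuclideanSpace ℝ (Fin d) → ℝ) :
    Set (EuclideanSpace ℝ (Fin d)) :=
  {x | D.value r g x = ENNReal.ofReal (g x)}

/-- `τ` is an optimal stopping time: it attains the supremum for every starting point. -/
def IsOptimal (D : ContinuousFamily d Ω) (r : ℝ) (g : EuclideanSpace ℝ (Fin d) → ℝ)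
    (τ : Ω → WithTop ℝ≥0) : Prop :=
  IsStoppingTime D.filtration τ ∧ ∀ x, ∫⁻ ω, D.payoff r g τ ω ∂D.P x = D.value r g x

end ContinuousFamily

/-! ### The time axis -/

/-! Write `W_U(x)` for the integral of `f` over `U` against `G_r(x, ·)`, so that `V = W_S` for the
stopping set `S`. A potential is the expected discounted reward collected along the whole path. By
the strong Markov property, it splits at the hitting time of a closed set into what is collected
before that time and the discounted potential at the hitting position
(`IsDiffusion.lintegral_green_eq_add`).

Optimality: if `W_U = g` on a closed set `U`, nothing is collected on `U` before `h_U`, so `W_U` is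
at most the payoff of `h_U`, hence at most `V` (`IsDiffusion.potentialOn_le_payoff`). For `U = S`
both ends equal `V`.

Uniqueness: a path started in `U` collects nothing off `U` until it meets the frontier, so the
boundary equation extends to all of `U` (`IsDiffusion.setIntegral_compl_eq_zero`). Thus `W_U = g` on
`U`, and `W_U ≤ V = W_S` everywhere. From a point of `S ∩ U`, where both potentials equal `g`, time
spent in `S` but off `U` before leaving `S` would make `W_S` strictly larger; there is none, and (i)
gives `S ⊆ U`. Now `W_U = W_S` on `S`, so time spent in `U` before `h_S` would make `W_U` exceed
`W_S`; again there is none, and (ii) gives `U ⊆ S`. -/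

theorem measurableEmbedding_nnreal_coe : MeasurableEmbedding ((↑) : ℝ≥0 → ℝ) :=
  MeasurableEmbedding.subtype_coe (measurableSet_Ici (a := (0 : ℝ)))

instance : SigmaFinite timeMeasure :=
  haveI : IsFiniteMeasureOnCompacts timeMeasure :=
    .comap' _ NNReal.continuous_coe measurableEmbedding_nnreal_coe
  inferInstance

instance : NullSingletonClass timeMeasure :=
  ⟨fun t => by rw [timeMeasure, measurableEmbedding_nnreal_coe.comap_apply]; simp⟩

theorem lintegral_timeMeasure_nnreal (F : ℝ≥0 → ℝ≥0∞) :
    ∫⁻ t, F t ∂timeMeasure = ∫⁻ t in Ici (0 : ℝ), F t.toNNReal := by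
  rw [← lintegral_timeMeasure]
  simp

theorem setLIntegral_Ici_timeMeasure (a : ℝ≥0) (F : ℝ≥0 → ℝ≥0∞) :
    ∫⁻ s in Ici a, F s ∂timeMeasure = ∫⁻ t, F (a + t) ∂timeMeasure := by
  rw [← lintegral_indicator measurableSet_Ici, lintegral_timeMeasure_nnreal,
    lintegral_timeMeasure_nnreal, ← lintegral_indicator measurableSet_Ici,
    ← lintegral_indicator measurableSet_Ici,
    ← lintegral_add_left_eq_self _ (a : ℝ)]
  congr 1 with t
  by_cases ht : 0 ≤ t
  · have h : (0 : ℝ) ≤ a + t := by positivity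
    have h' : ((a : ℝ) + t).toNNReal = a + t.toNNReal := by
      rw [Real.toNNReal_add a.coe_nonneg ht, Real.toNNReal_coe]
    simp [indicator, ht, h, h']
  -- For `t < 0` the shifted time lies before `a`, so the left integrand vanishes too.
  · by_cases h : (0 : ℝ) ≤ a + t
    · have h' : ¬ (a ≤ ((a : ℝ) + t).toNNReal) := fun hle => by
        have h1 : (a : ℝ) ≤ ((a : ℝ) + t).toNNReal := by exact_mod_cast hle
        rw [Real.coe_toNNReal _ h] at h1
        linarith
      simp [indicator, ht, h']
    · simp [indicator, ht, h]

/-- Discounted Lebesgue measure `e^{-rs} ds` on the time axis. -/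
noncomputable def discountedTime (r : ℝ) : Measure ℝ≥0 :=
  timeMeasure.withDensity fun s => ENNReal.ofReal (Real.exp (-r * s))

instance (r : ℝ) : SFinite (discountedTime r) := by
  unfold discountedTime; infer_instance

theorem measurable_discount (r : ℝ) :
    Measurable fun s : ℝ≥0 => ENNReal.ofReal (Real.exp (-r * s)) := by fun_prop

theorem discount_add (r : ℝ) (a t : ℝ≥0) :
    ENNReal.ofReal (Real.exp (-r * (a + t : ℝ≥0))) =
      ENNReal.ofReal (Real.exp (-r * a)) * ENNReal.ofReal (Real.exp (-r * t)) := by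
  rw [← ENNReal.ofReal_mul (Real.exp_pos _).le, ← Real.exp_add]
  push_cast
  ring_nf

theorem discountedTime_eq_zero_iff (r : ℝ) {A : Set ℝ≥0} :
    discountedTime r A = 0 ↔ timeMeasure A = 0 := by
  rw [discountedTime, withDensity_apply_eq_zero (measurable_discount r)]
  have : {s : ℝ≥0 | ENNReal.ofReal (Real.exp (-r * s)) ≠ 0} = univ := by
    ext s; simp [Real.exp_pos]
  rw [this, univ_inter]

/-- Exponential discounting turns a time shift into a constant factor; this is what makes the
potential after a stopping time a discounted potential. -/
theorem setLIntegral_Ici_discountedTime (r : ℝ) (a : ℝ≥0) {F : ℝ≥0 → ℝ≥0∞} (hF : Measurable F) :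
    ∫⁻ s in Ici a, F s ∂discountedTime r =
      ENNReal.ofReal (Real.exp (-r * a)) * ∫⁻ t, F (a + t) ∂discountedTime r := by
  rw [discountedTime, restrict_withDensity measurableSet_Ici,
    lintegral_withDensity_eq_lintegral_mul _ (measurable_discount r) hF,
    setLIntegral_Ici_timeMeasure,
    lintegral_withDensity_eq_lintegral_mul _ (measurable_discount r)
      (show Measurable fun t => F (a + t) from hF.comp (measurable_const_add a)),
    ← lintegral_const_mul _ ((measurable_discount r).mul
      (show Measurable fun t => F (a + t) from hF.comp (measurable_const_add a)))]
  congr 1 with t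
  simp only [Pi.mul_apply, discount_add, mul_assoc]

namespace ContinuousFamily

variable {d : ℕ} {Ω : Type*} [mΩ : MeasurableSpace Ω]

/-! ### Hitting times -/

theorem notMem_of_lt_hit (D : ContinuousFamily d Ω) {S : Set (EuclideanSpace ℝ (Fin d))}
    {ω : Ω} {s : ℝ≥0} (h : (s : WithTop ℝ≥0) < D.hit S ω) : D.X s ω ∉ S :=
  notMem_of_lt_hittingAfter h zero_le

theorem hit_mem_of_ne_top (D : ContinuousFamily d Ω) {S : Set (EuclideanSpace ℝ (Fin d))}
    (hS : IsClosed S) {ω : Ω} (h : D.hit S ω ≠ ⊤) : D.X (D.hit S ω).untopA ω ∈ S := by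
  have hex : ∃ j, 0 ≤ j ∧ D.X j ω ∈ S := by
    by_contra hex
    exact h (hittingAfter_eq_top_iff.2 fun j hj hm => hex ⟨j, hj, hm⟩)
  have hc : IsClosed {i : ℝ≥0 | 0 ≤ i ∧ D.X i ω ∈ S} := by
    convert hS.preimage (D.continuous_X ω) using 1
    ext i
    simp
  have := hc.csInf_mem hex (OrderBot.bddBelow _)
  rw [hit, hittingAfter, if_pos hex]
  exact this.2

theorem hit_le_coe_iff (D : ContinuousFamily d Ω) {S : Set (EuclideanSpace ℝ (Fin d))}
    (hS : IsClosed S) {ω : Ω} {t : ℝ≥0} :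
    D.hit S ω ≤ t ↔ ∃ s ≤ t, D.X s ω ∈ S := by
  constructor
  · intro h
    have h' : D.hit S ω ≠ ⊤ := fun h0 => WithTop.coe_ne_top (top_le_iff.1 (h0 ▸ h))
    exact ⟨_, (WithTop.untopA_le_iff h').2 h, D.hit_mem_of_ne_top hS h'⟩
  · rintro ⟨s, hs, hm⟩
    exact (hittingAfter_le_of_mem zero_le hm).trans (by exact_mod_cast hs)

theorem hit_anti (D : ContinuousFamily d Ω) {S S' : Set (EuclideanSpace ℝ (Fin d))}
    (h : S ⊆ S') (ω : Ω) : D.hit S' ω ≤ D.hit S ω :=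
  hittingAfter_apply_anti D.X 0 ω h

/-- A closed set is hit before time `t` iff the path comes arbitrarily close to it at a countable
set of times before `t`. -/
theorem setOf_hit_le (D : ContinuousFamily d Ω) {S : Set (EuclideanSpace ℝ (Fin d))}
    (hS : IsClosed S) (hne : S.Nonempty) (t : ℝ≥0) :
    {ω | D.hit S ω ≤ t} = ⋂ n : ℕ, ⋃ i : ℕ,
      {ω | Metric.infDist (D.X (min (TopologicalSpace.denseSeq ℝ≥0 i) t) ω) S < 1 / (n + 1)} := by
  ext ω
  simp only [mem_ofPred_eq, mem_iInter, mem_iUnion, D.hit_le_coe_iff hS]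
  have hcont : Continuous fun u => Metric.infDist (D.X u ω) S :=
    (Metric.continuous_infDist_pt S).comp (D.continuous_X ω)
  constructor
  · rintro ⟨s, hs, hm⟩ n
    -- The cap `min u t` keeps sampled times in `[0, t]`; openness around `s` lets the dense
    -- sequence replace `s`.
    have ho : IsOpen {u : ℝ≥0 | Metric.infDist (D.X (min u t) ω) S < 1 / ((n : ℝ) + 1)} :=
      isOpen_lt (hcont.comp (by fun_prop)) continuous_const
    obtain ⟨_, hu, i, rfl⟩ := (TopologicalSpace.denseRange_denseSeq ℝ≥0).inter_open_nonempty _ ho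
      ⟨s, by
        simp only [mem_ofPred_eq, min_eq_left hs, Metric.infDist_zero_of_mem hm]
        positivity⟩
    exact ⟨i, hu⟩
  · intro h
    -- By compactness the distance to `S` attains its minimum on `[0, t]`, and this minimum is below
    -- every `1 / (n + 1)`.
    obtain ⟨s, hs, hmin⟩ := (isCompact_Icc (a := (0 : ℝ≥0)) (b := t)).exists_isMinOn
      ⟨0, by simp⟩ hcont.continuousOn
    refine ⟨s, hs.2, (hS.mem_iff_infDist_zero hne).2 (le_antisymm ?_ Metric.infDist_nonneg)⟩
    refine ge_of_tendsto' tendsto_one_div_add_atTop_nhds_zero_nat fun n => ?_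
    obtain ⟨i, hi⟩ := h n
    exact (hmin (show min _ t ∈ Icc 0 t from ⟨zero_le, min_le_right _ _⟩)).trans hi.le

theorem measurableSet_hit_le (D : ContinuousFamily d Ω) {S : Set (EuclideanSpace ℝ (Fin d))}
    (hS : IsClosed S) (t : ℝ≥0) : MeasurableSet[D.rawFiltration t] {ω | D.hit S ω ≤ t} := by
  rcases S.eq_empty_or_nonempty with rfl | hne
  · have : {ω | D.hit ∅ ω ≤ t} = ∅ := by
      ext ω
      simpa [hit, -top_le_iff] using fun h => WithTop.coe_ne_top (top_le_iff.1 h)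
    rw [this]
    exact @MeasurableSet.empty _ (D.rawFiltration t)
  · rw [D.setOf_hit_le hS hne]
    refine @MeasurableSet.iInter _ _ (D.rawFiltration t) _ _ fun n =>
      @MeasurableSet.iUnion _ ℕ (D.rawFiltration t) _ _ fun i => ?_
    have hX : StronglyMeasurable[D.rawFiltration t]
        (D.X (min (TopologicalSpace.denseSeq ℝ≥0 i) t)) :=
      StronglyMeasurable.mono (Filtration.stronglyAdapted_natural
        (fun t => (D.measurable_X t).stronglyMeasurable) _)
        (D.rawFiltration.mono (min_le_right _ _))
    exact ((Metric.continuous_infDist_pt S).comp_stronglyMeasurable hX).measurable measurableSet_Iio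

/-- Being a stopping time of the augmented filtration only gives measurability up to null sets;
Tonelli arguments need it for the original `σ`-algebra. -/
theorem measurable_hit (D : ContinuousFamily d Ω) {S : Set (EuclideanSpace ℝ (Fin d))}
    (hS : IsClosed S) : Measurable (D.hit S) := by
  refine measurable_of_Iic fun i ↦ ?_
  cases i with
  | top => simp
  | coe i => exact D.rawFiltration.le i _ (D.measurableSet_hit_le hS i)

theorem isStoppingTime_hit (D : ContinuousFamily d Ω) {S : Set (EuclideanSpace ℝ (Fin d))}
    (hS : IsClosed S) : IsStoppingTime D.filtration (D.hit S) := by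
  intro t
  refine MeasurableSpace.measurableSet_iInf.2 fun ν => ?_
  exact ⟨_, D.measurableSet_hit_le hS t, EventuallyEq.rfl⟩

/-- A continuous path that starts in a set stays there before it hits the frontier. -/
theorem mem_of_lt_hit_frontier (D : ContinuousFamily d Ω) {U : Set (EuclideanSpace ℝ (Fin d))}
    {ω : Ω} (h0 : D.X 0 ω ∈ U) {s : ℝ≥0} (hs : (s : WithTop ℝ≥0) < D.hit (frontier U) ω) :
    D.X s ω ∈ U := by
  by_contra hm
  have hpre : IsPreconnected ((fun t => D.X t ω) '' Icc 0 s) :=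
    isPreconnected_Icc.image _ (D.continuous_X ω).continuousOn
  have hd : ∀ t ∈ Icc 0 s, D.X t ω ∉ frontier U := fun t ht =>
    D.notMem_of_lt_hit (lt_of_le_of_lt (by exact_mod_cast ht.2) hs)
  -- Off the frontier the space is the disjoint union of two open sets, and a connected piece of
  -- path lies in one of them.
  have := isPreconnected_iff_subset_of_disjoint.1 hpre (interior U) (closure U)ᶜ isOpen_interior
    isClosed_closure.isOpen_compl
  have key : ∀ t ∈ Icc 0 s, D.X t ω ∈ interior U ∨ D.X t ω ∈ (closure U)ᶜ := fun t ht => by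
    have := hd t ht
    rw [frontier, Set.mem_sdiff] at this
    simp only [mem_compl_iff]
    tauto
  rcases this (by rintro _ ⟨t, ht, rfl⟩; exact key t ht) (by
    ext y
    simp only [mem_inter_iff, mem_compl_iff, mem_empty_iff_false, iff_false, not_and, not_not]
    exact fun _ h => subset_closure (interior_subset h)) with h | h
  · exact hm (interior_subset (h ⟨s, by simp, rfl⟩))
  · exact h ⟨0, by simp, rfl⟩ (subset_closure h0)

/-- A time that precedes the hitting times of sets covering `S` precedes the hitting time of `S`. -/
theorem le_hit_of_forall_le (D : ContinuousFamily d Ω)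
    {S : Set (EuclideanSpace ℝ (Fin d))} {K : ℕ → Set (EuclideanSpace ℝ (Fin d))}
    (hK : S ⊆ ⋃ n, K n) {ω : Ω} {t : ℝ≥0} (h : ∀ n, (t : WithTop ℝ≥0) ≤ D.hit (K n) ω) :
    (t : WithTop ℝ≥0) ≤ D.hit S ω := by
  by_contra hlt
  rw [not_le] at hlt
  obtain ⟨j, hj, hm⟩ := hittingAfter_lt_iff.1 hlt
  obtain ⟨n, hn⟩ := mem_iUnion.1 (hK hm)
  exact absurd ((h n).trans (hittingAfter_le_of_mem zero_le hn)) (by exact_mod_cast hj.2.not_ge)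

/-! ### The strong Markov property for potentials -/

/-- The discounted law of a path observed along the time axis. -/
noncomputable def pathMeasure (D : ContinuousFamily d Ω) (r : ℝ) (x : EuclideanSpace ℝ (Fin d)) :
    Measure (ℝ≥0 × Ω) :=
  (discountedTime r).prod (D.P x)

theorem green_eq_map (D : ContinuousFamily d Ω) (r : ℝ) (x : EuclideanSpace ℝ (Fin d)) :
    D.green r x = (D.pathMeasure r x).map fun p => D.X p.1 p.2 := rfl

theorem lintegral_green (D : ContinuousFamily d Ω) (r : ℝ) (x : EuclideanSpace ℝ (Fin d))
    {φ : EuclideanSpace ℝ (Fin d) → ℝ≥0∞} (hφ : Measurable φ) :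
    ∫⁻ y, φ y ∂D.green r x = ∫⁻ p, φ (D.X p.1 p.2) ∂D.pathMeasure r x := by
  rw [green_eq_map, lintegral_map hφ D.measurable_uncurry]

theorem measurable_lintegral_law (D : ContinuousFamily d Ω)
    {φ : EuclideanSpace ℝ (Fin d) → ℝ≥0∞} (hφ : Measurable φ) :
    Measurable fun p : ℝ≥0 × EuclideanSpace ℝ (Fin d) => ∫⁻ ω, φ (D.X p.1 ω) ∂D.P p.2 := by
  have h : Measurable fun q : (ℝ≥0 × EuclideanSpace ℝ (Fin d)) × Ω => φ (D.X q.1.1 q.2) :=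
    hφ.comp (D.measurable_uncurry.comp ((measurable_fst.comp measurable_fst).prodMk measurable_snd))
  exact Measurable.lintegral_kernel_prod_right' (κ := D.P.comap Prod.snd measurable_snd) h

theorem measurable_X_untopA_add (D : ContinuousFamily d Ω) {τ : Ω → WithTop ℝ≥0}
    (hτ : Measurable τ) : Measurable fun p : ℝ≥0 × Ω => D.X ((τ p.2).untopA + p.1) p.2 :=
  D.measurable_uncurry.comp (((hτ.comp measurable_snd).untopA.add measurable_fst).prodMk
    measurable_snd)

theorem measurable_stoppedValue (D : ContinuousFamily d Ω) {τ : Ω → WithTop ℝ≥0}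
    (hτ : Measurable τ) : Measurable (stoppedValue D.X τ) :=
  D.measurable_uncurry.comp (hτ.untopA.prodMk measurable_id)

theorem measurableSet_ne_top {τ : Ω → WithTop ℝ≥0} (hτ : Measurable τ) :
    MeasurableSet {ω | τ ω ≠ ⊤} :=
  (hτ (measurableSet_singleton ⊤)).compl

/-- The strong Markov property for functions of the stopping time and the position after it. -/
theorem IsDiffusion.lintegral_strong_markov {D : ContinuousFamily d Ω} (hD : D.IsDiffusion)
    {τ : Ω → WithTop ℝ≥0} (hτ : IsStoppingTime D.filtration τ) (hm : Measurable τ)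
    (x : EuclideanSpace ℝ (Fin d)) (t : ℝ≥0)
    {φ : EuclideanSpace ℝ (Fin d) → ℝ≥0∞} (hφ : Measurable φ) {w : WithTop ℝ≥0 → ℝ≥0∞}
    (hw : Measurable w) :
    ∫⁻ ω in {ω | τ ω ≠ ⊤}, w (τ ω) * φ (D.X ((τ ω).untopA + t) ω) ∂D.P x =
      ∫⁻ ω in {ω | τ ω ≠ ⊤}, w (τ ω) *
        ∫⁻ ω', φ (D.X t ω') ∂D.P (stoppedValue D.X τ ω) ∂D.P x := by
  have hX : Measurable fun ω => D.X ((τ ω).untopA + t) ω :=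
    (D.measurable_X_untopA_add hm).comp measurable_prodMk_left
  have hsv := D.measurable_stoppedValue hm
  have hlaw : Measurable fun z => ∫⁻ ω', φ (D.X t ω') ∂D.P z :=
    (D.measurable_lintegral_law hφ).comp measurable_prodMk_left
  have hsets : ∀ C : Set (WithTop ℝ≥0), MeasurableSet C →
      ∫⁻ ω in τ ⁻¹' C, φ (D.X ((τ ω).untopA + t) ω) ∂(D.P x).restrict {ω | τ ω ≠ ⊤} =
      ∫⁻ ω in τ ⁻¹' C, ∫⁻ ω', φ (D.X t ω') ∂D.P (stoppedValue D.X τ ω)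
        ∂(D.P x).restrict {ω | τ ω ≠ ⊤} := by
    intro C hC
    have hCm : MeasurableSet (τ ⁻¹' C) := hm hC
    set μ := ((D.P x).restrict {ω | τ ω ≠ ⊤}).restrict (τ ⁻¹' C) with hμ
    have hk : Measurable fun ω => (D.P.map (D.X t)) (stoppedValue D.X τ ω) :=
      (D.P.map (D.X t)).measurable.comp hsv
    -- The set form of the strong Markov property, on the event `{τ ∈ C, τ < ∞}`, identifies two
    -- measures on the state space; integrating `φ` extends it to functions.
    have hmeas : μ.map (fun ω => D.X ((τ ω).untopA + t) ω) =
        μ.bind fun ω => (D.P.map (D.X t)) (stoppedValue D.X τ ω) := by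
      ext B hB
      rw [Measure.map_apply hX hB, Measure.bind_apply hB hk.aemeasurable, hμ,
        Measure.restrict_apply (hX hB), Measure.restrict_apply ((hX hB).inter hCm),
        Measure.restrict_restrict hCm]
      simp only [Kernel.map_apply' _ (D.measurable_X t) _ hB]
      have := hD.strong_markov τ hτ x (τ ⁻¹' C) (hτ.measurable hC) t B hB
      refine Eq.trans ?_ this
      congr 1
      ext ω
      simp only [mem_inter_iff, mem_preimage, mem_ofPred_eq]
      tauto
    rw [← lintegral_map hφ hX, hmeas, Measure.lintegral_bind hk.aemeasurable hφ.aemeasurable]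
    congr 1 with ω
    rw [Kernel.map_apply _ (D.measurable_X t), lintegral_map hφ (D.measurable_X t)]
  set ν := (D.P x).restrict {ω | τ ω ≠ ⊤}
  -- Agreement on every event `{τ ∈ C}` means that both densities have the same image under `τ`;
  -- integrating `w` against it inserts the weight `w (τ ω)`.
  have hmap : (ν.withDensity fun ω => φ (D.X ((τ ω).untopA + t) ω)).map τ =
      (ν.withDensity fun ω => ∫⁻ ω', φ (D.X t ω') ∂D.P (stoppedValue D.X τ ω)).map τ := by
    ext C hC
    rw [Measure.map_apply hm hC, Measure.map_apply hm hC, withDensity_apply _ (hm hC),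
      withDensity_apply _ (hm hC), hsets C hC]
  have := congrArg (fun m => ∫⁻ s, w s ∂m) hmap
  rw [lintegral_map hw hm, lintegral_map hw hm,
    lintegral_withDensity_eq_lintegral_mul _
      (show Measurable fun ω => φ (D.X ((τ ω).untopA + t) ω) from hφ.comp hX)
      (show Measurable fun ω => w (τ ω) from hw.comp hm),
    lintegral_withDensity_eq_lintegral_mul _
      (show Measurable fun ω => ∫⁻ ω', φ (D.X t ω') ∂D.P (stoppedValue D.X τ ω) from hlaw.comp hsv)
      (show Measurable fun ω => w (τ ω) from hw.comp hm)] at this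
  simpa only [Pi.mul_apply, mul_comm] using this

/-- The part of a potential that is collected after a stopping time is the discounted potential
at the stopped position. -/
theorem IsDiffusion.setLIntegral_after_stoppingTime {D : ContinuousFamily d Ω}
    (hD : D.IsDiffusion) (r : ℝ)
    {τ : Ω → WithTop ℝ≥0} (hτ : IsStoppingTime D.filtration τ) (hm : Measurable τ)
    (x : EuclideanSpace ℝ (Fin d)) {φ : EuclideanSpace ℝ (Fin d) → ℝ≥0∞} (hφ : Measurable φ) :
    ∫⁻ p in {p : ℝ≥0 × Ω | τ p.2 ≤ p.1}, φ (D.X p.1 p.2) ∂D.pathMeasure r x =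
      ∫⁻ ω in {ω | τ ω ≠ ⊤}, ENNReal.ofReal (Real.exp (-r * (τ ω).untopA)) *
        ∫⁻ y, φ y ∂D.green r (stoppedValue D.X τ ω) ∂D.P x := by
  have hfin := measurableSet_ne_top hm
  have hle : MeasurableSet {p : ℝ≥0 × Ω | τ p.2 ≤ p.1} :=
    measurableSet_le (hm.comp measurable_snd) measurable_fst.withTop_coe
  have hφX : Measurable fun p : ℝ≥0 × Ω => φ (D.X p.1 p.2) := hφ.comp D.measurable_uncurry
  have hφτ : Measurable fun p : ℝ≥0 × Ω => φ (D.X ((τ p.2).untopA + p.1) p.2) :=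
    hφ.comp (D.measurable_X_untopA_add hm)
  have hw : Measurable fun s : WithTop ℝ≥0 => ENNReal.ofReal (Real.exp (-r * s.untopA)) :=
    (measurable_discount r).comp WithTop.measurable_untopA
  have hlaw := D.measurable_lintegral_law hφ
  have hsv := D.measurable_stoppedValue hm
  calc ∫⁻ p in {p : ℝ≥0 × Ω | τ p.2 ≤ p.1}, φ (D.X p.1 p.2) ∂D.pathMeasure r x
      = ∫⁻ ω, ∫⁻ s, {p : ℝ≥0 × Ω | τ p.2 ≤ p.1}.indicator
          (fun p => φ (D.X p.1 p.2)) (s, ω) ∂discountedTime r ∂D.P x := by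
        rw [← lintegral_indicator hle, pathMeasure,
          lintegral_prod_symm _ (hφX.indicator hle).aemeasurable]
    _ = ∫⁻ ω in {ω | τ ω ≠ ⊤}, ∫⁻ t, ENNReal.ofReal (Real.exp (-r * (τ ω).untopA)) *
          φ (D.X ((τ ω).untopA + t) ω) ∂discountedTime r ∂D.P x := by
        rw [← lintegral_indicator hfin]
        congr 1 with ω
        by_cases hω : τ ω = ⊤
        · have h : ∀ s : ℝ≥0, ¬ τ ω ≤ s := fun s hs => WithTop.coe_ne_top (top_le_iff.1 (hω ▸ hs))
          have h0 : ∀ s : ℝ≥0, {p : ℝ≥0 × Ω | τ p.2 ≤ p.1}.indicator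
              (fun p => φ (D.X p.1 p.2)) (s, ω) = 0 := fun s =>
            indicator_of_notMem (by exact h s) _
          rw [indicator_of_notMem (by simpa using hω)]
          simp only [h0, lintegral_zero]
        · rw [indicator_of_mem (by exact hω), lintegral_const_mul _
            (show Measurable fun t => φ (D.X ((τ ω).untopA + t) ω) from
              hφτ.comp measurable_prodMk_right),
            ← setLIntegral_Ici_discountedTime r (τ ω).untopA
              (show Measurable fun s => φ (D.X s ω) from hφX.comp measurable_prodMk_right),
            ← lintegral_indicator measurableSet_Ici]
          congr 1 with s
          by_cases hs : τ ω ≤ s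
          · rw [indicator_of_mem (by exact hs),
              indicator_of_mem (mem_Ici.2 ((WithTop.untopA_le_iff hω).2 hs))]
          · rw [indicator_of_notMem (by exact hs),
              indicator_of_notMem fun h => hs ((WithTop.untopA_le_iff hω).1 (mem_Ici.1 h))]
    -- Tonelli moves time outside, so that the strong Markov property applies at each fixed `t`; the
    -- swap is undone afterwards.
    _ = ∫⁻ t, ∫⁻ ω in {ω | τ ω ≠ ⊤}, ENNReal.ofReal (Real.exp (-r * (τ ω).untopA)) *
          φ (D.X ((τ ω).untopA + t) ω) ∂D.P x ∂discountedTime r := by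
        rw [lintegral_lintegral_swap]
        exact (((hw.comp hm).comp measurable_fst).mul (hφτ.comp measurable_swap)).aemeasurable
    _ = ∫⁻ t, ∫⁻ ω in {ω | τ ω ≠ ⊤}, ENNReal.ofReal (Real.exp (-r * (τ ω).untopA)) *
          ∫⁻ ω', φ (D.X t ω') ∂D.P (stoppedValue D.X τ ω) ∂D.P x ∂discountedTime r := by
        congr 1 with t
        exact hD.lintegral_strong_markov hτ hm x t hφ hw
    _ = ∫⁻ ω in {ω | τ ω ≠ ⊤}, ∫⁻ t, ENNReal.ofReal (Real.exp (-r * (τ ω).untopA)) *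
          ∫⁻ ω', φ (D.X t ω') ∂D.P (stoppedValue D.X τ ω) ∂discountedTime r ∂D.P x := by
        rw [lintegral_lintegral_swap]
        exact (((hw.comp hm).comp measurable_snd).mul (hlaw.comp (measurable_fst.prodMk
          (hsv.comp measurable_snd)))).aemeasurable
    _ = _ := by
        congr 1 with ω
        rw [lintegral_const_mul _ (show Measurable fun t =>
            ∫⁻ ω', φ (D.X t ω') ∂D.P (stoppedValue D.X τ ω) from
            hlaw.comp measurable_prodMk_right), D.lintegral_green r _ hφ, pathMeasure,
          lintegral_prod _ hφX.aemeasurable]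

/-- A potential splits into the part collected before hitting a closed set and the discounted
potential at the hitting position. -/
theorem IsDiffusion.lintegral_green_eq_add {D : ContinuousFamily d Ω}
    (hD : D.IsDiffusion) (r : ℝ) {K : Set (EuclideanSpace ℝ (Fin d))} (hK : IsClosed K)
    (x : EuclideanSpace ℝ (Fin d)) {φ : EuclideanSpace ℝ (Fin d) → ℝ≥0∞} (hφ : Measurable φ) :
    ∫⁻ y, φ y ∂D.green r x =
      ∫⁻ p in {p : ℝ≥0 × Ω | (p.1 : WithTop ℝ≥0) < D.hit K p.2}, φ (D.X p.1 p.2)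
          ∂D.pathMeasure r x +
      ∫⁻ ω in {ω | D.hit K ω ≠ ⊤}, ENNReal.ofReal (Real.exp (-r * (D.hit K ω).untopA)) *
        ∫⁻ y, φ y ∂D.green r (stoppedValue D.X (D.hit K) ω) ∂D.P x := by
  have hm := D.measurable_hit hK
  rw [← hD.setLIntegral_after_stoppingTime r (D.isStoppingTime_hit hK) hm x hφ,
    D.lintegral_green r x hφ, ← lintegral_add_compl _
      (measurableSet_lt measurable_fst.withTop_coe (hm.comp measurable_snd))]
  congr 3
  ext p
  exact (not_lt (α := WithTop ℝ≥0))

theorem ae_pathMeasure_start (D : ContinuousFamily d Ω) (r : ℝ) (x : EuclideanSpace ℝ (Fin d)) :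
    ∀ᵐ p ∂D.pathMeasure r x, D.X 0 p.2 = x :=
  Measure.quasiMeasurePreserving_snd.ae (D.start x)

/-- If `φ` vanishes along the path before it hits `K`, the potential of `φ` comes from the hitting
position alone. -/
theorem IsDiffusion.lintegral_green_eq_of_forall {D : ContinuousFamily d Ω}
    (hD : D.IsDiffusion) (r : ℝ) {K : Set (EuclideanSpace ℝ (Fin d))} (hK : IsClosed K)
    (x : EuclideanSpace ℝ (Fin d)) {φ : EuclideanSpace ℝ (Fin d) → ℝ≥0∞} (hφ : Measurable φ)
    (h : ∀ ω, D.X 0 ω = x → ∀ s : ℝ≥0, (s : WithTop ℝ≥0) < D.hit K ω → φ (D.X s ω) = 0) :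
    ∫⁻ y, φ y ∂D.green r x =
      ∫⁻ ω in {ω | D.hit K ω ≠ ⊤}, ENNReal.ofReal (Real.exp (-r * (D.hit K ω).untopA)) *
        ∫⁻ y, φ y ∂D.green r (stoppedValue D.X (D.hit K) ω) ∂D.P x := by
  rw [hD.lintegral_green_eq_add r hK x hφ]
  have h0 : ∫⁻ p in {p : ℝ≥0 × Ω | (p.1 : WithTop ℝ≥0) < D.hit K p.2}, φ (D.X p.1 p.2)
      ∂D.pathMeasure r x = 0 := by
    refine (setLIntegral_eq_zero_iff (measurableSet_lt measurable_fst.withTop_coe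
      ((D.measurable_hit hK).comp measurable_snd)) (hφ.comp D.measurable_uncurry)).2 ?_
    filter_upwards [D.ae_pathMeasure_start r x] with p hp hlt
    exact h p.2 hp p.1 hlt
  rw [h0, zero_add]

end ContinuousFamily

/-! ### Signed integrals, null sets of times and potentials on a set -/

/-- The Markov splitting concerns nonnegative functions, whereas `f` may change sign off `U`; its
two parts are therefore treated separately. -/
theorem integral_eq_zero_iff_lintegral_eq {α : Type*} {_ : MeasurableSpace α} {μ : Measure α}
    {h : α → ℝ} (hh : Integrable h μ) :
    ∫ y, h y ∂μ = 0 ↔ ∫⁻ y, ENNReal.ofReal (h y) ∂μ = ∫⁻ y, ENNReal.ofReal (-h y) ∂μ := by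
  rw [integral_eq_lintegral_pos_part_sub_lintegral_neg_part hh, sub_eq_zero]
  exact ENNReal.toReal_eq_toReal_iff' hh.lintegral_lt_top.ne hh.neg.lintegral_lt_top.ne

namespace ContinuousFamily

variable {d : ℕ} {Ω : Type*} [mΩ : MeasurableSpace Ω]

theorem pathMeasure_eq_zero_iff (D : ContinuousFamily d Ω) (r : ℝ)
    (x : EuclideanSpace ℝ (Fin d)) {s : Set (ℝ≥0 × Ω)} (hs : MeasurableSet s) :
    D.pathMeasure r x s = 0 ↔ ∀ᵐ ω ∂D.P x, timeMeasure {t | (t, ω) ∈ s} = 0 := by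
  rw [pathMeasure, Measure.prod_apply_symm hs,
    lintegral_eq_zero_iff (measurable_measure_prodMk_right hs)]
  simp only [EventuallyEq, Pi.zero_apply, discountedTime_eq_zero_iff]
  rfl

/-- The single instant `t = τ ω` is Lebesgue null. Splitting potentials yields `<`, while conditions
(i) and (ii) use `≤`. -/
theorem ae_timeMeasure_le_eq_zero {τ : Ω → WithTop ℝ≥0} {μ : Measure Ω} {Q : ℝ≥0 → Ω → Prop}
    (h : ∀ᵐ ω ∂μ, timeMeasure {t : ℝ≥0 | (t : WithTop ℝ≥0) < τ ω ∧ Q t ω} = 0) :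
    ∀ᵐ ω ∂μ, timeMeasure {t : ℝ≥0 | (t : WithTop ℝ≥0) ≤ τ ω ∧ Q t ω} = 0 := by
  filter_upwards [h] with ω hω
  have hsub : {t : ℝ≥0 | (t : WithTop ℝ≥0) ≤ τ ω ∧ Q t ω} ⊆
      {t : ℝ≥0 | (t : WithTop ℝ≥0) < τ ω ∧ Q t ω} ∪ {t : ℝ≥0 | (t : WithTop ℝ≥0) = τ ω} := by
    rintro t ⟨ht, hQ⟩
    rcases ht.lt_or_eq with h | h
    · exact Or.inl ⟨h, hQ⟩
    · exact Or.inr h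
  refine measure_mono_null hsub (measure_union_null hω (Set.Subsingleton.measure_zero ?_ _))
  intro s hs t ht
  exact WithTop.coe_injective (Eq.trans hs (Eq.symm ht))

/-- The potential of the positive part of `f` restricted to `U`. -/
noncomputable def potentialOn (D : ContinuousFamily d Ω) (r : ℝ)
    (f : EuclideanSpace ℝ (Fin d) → ℝ) (U : Set (EuclideanSpace ℝ (Fin d)))
    (x : EuclideanSpace ℝ (Fin d)) : ℝ≥0∞ :=
  ∫⁻ y, U.indicator (fun y => ENNReal.ofReal (f y)) y ∂D.green r x

theorem potentialOn_eq_ofReal (D : ContinuousFamily d Ω) (r : ℝ)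
    {f : EuclideanSpace ℝ (Fin d) → ℝ} {U : Set (EuclideanSpace ℝ (Fin d))}
    (hU : MeasurableSet U) (hpos : ∀ y ∈ U, 0 ≤ f y) {x : EuclideanSpace ℝ (Fin d)}
    (hf : Integrable f (D.green r x)) :
    D.potentialOn r f U x = ENNReal.ofReal (∫ y in U, f y ∂D.green r x) := by
  rw [potentialOn, lintegral_indicator hU, ofReal_integral_eq_lintegral_ofReal hf.integrableOn]
  filter_upwards [ae_restrict_mem hU] with y hy using hpos y hy

/-! ### Stopping at a closed set -/

theorem payoff_of_ne_top (D : ContinuousFamily d Ω) (r : ℝ)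
    (g : EuclideanSpace ℝ (Fin d) → ℝ) {τ : Ω → WithTop ℝ≥0} {ω : Ω} (h : τ ω ≠ ⊤) :
    D.payoff r g τ ω = ENNReal.ofReal (Real.exp (-r * (τ ω).untopA)) *
      ENNReal.ofReal (g (stoppedValue D.X τ ω)) := by
  obtain ⟨t, ht⟩ := WithTop.ne_top_iff_exists.1 h
  rw [payoff, stoppedValue, ← ht, ← ENNReal.ofReal_mul (Real.exp_pos _).le]
  rfl

/-- If the potential on `U` agrees with the reward on `U`, it is at most the expected payoff of
stopping at `U`. -/
theorem IsDiffusion.potentialOn_le_payoff {D : ContinuousFamily d Ω} (hD : D.IsDiffusion) {r : ℝ}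
    {g f : EuclideanSpace ℝ (Fin d) → ℝ} (hf : Measurable f)
    {U : Set (EuclideanSpace ℝ (Fin d))} (hU : IsClosed U)
    (h : ∀ y ∈ U, D.potentialOn r f U y = ENNReal.ofReal (g y)) (x : EuclideanSpace ℝ (Fin d)) :
    D.potentialOn r f U x ≤ ∫⁻ ω, D.payoff r g (D.hit U) ω ∂D.P x := by
  have hm := measurableSet_ne_top (D.measurable_hit hU)
  rw [potentialOn, hD.lintegral_green_eq_of_forall r hU x
    (hf.ennreal_ofReal.indicator hU.measurableSet)
    fun ω _ s hs => indicator_of_notMem (D.notMem_of_lt_hit hs) _]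
  -- The payoff on `{h_U = ∞}` is a nonnegative limsup and is dropped.
  refine le_trans (le_of_eq ?_) (setLIntegral_le_lintegral {ω | D.hit U ω ≠ ⊤} _)
  refine setLIntegral_congr_fun hm fun ω hω => ?_
  simp only [D.payoff_of_ne_top r g hω, ← h _ (D.hit_mem_of_ne_top hU hω), potentialOn,
    stoppedValue]

theorem payoff_hit_le_value (D : ContinuousFamily d Ω) (r : ℝ)
    (g : EuclideanSpace ℝ (Fin d) → ℝ) {U : Set (EuclideanSpace ℝ (Fin d))} (hU : IsClosed U)
    (x : EuclideanSpace ℝ (Fin d)) :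
    ∫⁻ ω, D.payoff r g (D.hit U) ω ∂D.P x ≤ D.value r g x :=
  le_iSup₂_of_le (D.hit U) (D.isStoppingTime_hit hU) le_rfl

/-- If the potential of `f` off `U` vanishes on the frontier of `U`, it vanishes on `U`. -/
theorem IsDiffusion.setIntegral_compl_eq_zero {D : ContinuousFamily d Ω} (hD : D.IsDiffusion)
    {r : ℝ} {f : EuclideanSpace ℝ (Fin d) → ℝ} (hf : Measurable f)
    (hfint : ∀ x, Integrable f (D.green r x))
    {U : Set (EuclideanSpace ℝ (Fin d))} (hU : MeasurableSet U)
    (h : ∀ x ∈ frontier U, ∫ y in Uᶜ, f y ∂D.green r x = 0)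
    {x : EuclideanSpace ℝ (Fin d)} (hx : x ∈ U) : ∫ y in Uᶜ, f y ∂D.green r x = 0 := by
  have hfin := measurableSet_ne_top (D.measurable_hit (isClosed_frontier (s := U)))
  have heq : ∀ z, ∫ y in Uᶜ, f y ∂D.green r z = 0 ↔
      ∫⁻ y, Uᶜ.indicator (fun y => ENNReal.ofReal (f y)) y ∂D.green r z =
        ∫⁻ y, Uᶜ.indicator (fun y => ENNReal.ofReal (-f y)) y ∂D.green r z := fun z => by
    rw [integral_eq_zero_iff_lintegral_eq (hfint z).integrableOn, lintegral_indicator hU.compl,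
      lintegral_indicator hU.compl]
  have hstay : ∀ ω, D.X 0 ω = x → ∀ s : ℝ≥0, (s : WithTop ℝ≥0) < D.hit (frontier U) ω →
      D.X s ω ∉ Uᶜ := fun ω h0 s hs =>
    not_not.2 (D.mem_of_lt_hit_frontier (h0.symm ▸ hx) hs)
  rw [heq, hD.lintegral_green_eq_of_forall r isClosed_frontier x
      (hf.ennreal_ofReal.indicator hU.compl)
      fun ω h0 s hs => indicator_of_notMem (hstay ω h0 s hs) _,
    hD.lintegral_green_eq_of_forall r isClosed_frontier x
      (φ := Uᶜ.indicator fun y => ENNReal.ofReal (-f y))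
      (hf.neg.ennreal_ofReal.indicator hU.compl)
      fun ω h0 s hs => indicator_of_notMem (hstay ω h0 s hs) _]
  refine setLIntegral_congr_fun hfin fun ω hω => ?_
  exact congrArg _ ((heq _).1 (h _ (D.hit_mem_of_ne_top isClosed_frontier hω)))

/-! ### Comparison of two sets -/

/-- If the potential on `U` is dominated by that on `S` and agrees with it on `S`, then before
hitting `S` the process spends no time in `U`. -/
theorem IsDiffusion.ae_time_before_hit_eq_zero {D : ContinuousFamily d Ω} (hD : D.IsDiffusion)
    {r : ℝ} {f : EuclideanSpace ℝ (Fin d) → ℝ} (hf : Measurable f)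
    {S U : Set (EuclideanSpace ℝ (Fin d))} (hS : IsClosed S) (hU : MeasurableSet U)
    (hpos : ∀ y ∈ U, 0 < f y) (heq : ∀ y ∈ S, D.potentialOn r f U y = D.potentialOn r f S y)
    {x : EuclideanSpace ℝ (Fin d)} (hle : D.potentialOn r f U x ≤ D.potentialOn r f S x)
    (hfin : D.potentialOn r f S x ≠ ⊤) :
    ∀ᵐ ω ∂D.P x, timeMeasure {t : ℝ≥0 | (t : WithTop ℝ≥0) ≤ D.hit S ω ∧ D.X t ω ∈ U} = 0 := by
  have hm := D.measurable_hit hS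
  have hlt : MeasurableSet {p : ℝ≥0 × Ω | (p.1 : WithTop ℝ≥0) < D.hit S p.2} :=
    measurableSet_lt measurable_fst.withTop_coe (hm.comp measurable_snd)
  have hmU := hf.ennreal_ofReal.indicator hU
  have h1 := hD.lintegral_green_eq_add r hS x hmU
  have h2 := hD.lintegral_green_eq_of_forall r hS x
    (hf.ennreal_ofReal.indicator hS.measurableSet)
    fun ω _ s hs => indicator_of_notMem (D.notMem_of_lt_hit hs) _
  have h3 : ∫⁻ ω in {ω | D.hit S ω ≠ ⊤}, ENNReal.ofReal (Real.exp (-r * (D.hit S ω).untopA)) *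
        D.potentialOn r f U (stoppedValue D.X (D.hit S) ω) ∂D.P x = D.potentialOn r f S x := by
    rw [potentialOn, h2]
    refine setLIntegral_congr_fun (measurableSet_ne_top hm) fun ω hω => ?_
    exact congrArg _ (heq _ (D.hit_mem_of_ne_top hS hω))
  change D.potentialOn r f U x = _ + ∫⁻ ω in {ω | D.hit S ω ≠ ⊤},
    ENNReal.ofReal (Real.exp (-r * (D.hit S ω).untopA)) *
      D.potentialOn r f U (stoppedValue D.X (D.hit S) ω) ∂D.P x at h1
  rw [h3] at h1
  -- Cancelling the finite potential on `S` leaves nothing collected on `U` before the hitting time.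
  have h4 := ENNReal.le_of_add_le_add_right (c := 0) hfin
    (h1.symm.le.trans (hle.trans (zero_add _).ge))
  rw [nonpos_iff_eq_zero, setLIntegral_eq_zero_iff hlt 
    (show Measurable fun p : ℝ≥0 × Ω => U.indicator _ (D.X p.1 p.2) from
      hmU.comp D.measurable_uncurry)] at h4
  refine ae_timeMeasure_le_eq_zero ((D.pathMeasure_eq_zero_iff r x
    (hlt.inter (D.measurable_uncurry hU))).1 ?_)
  refine measure_eq_zero_iff_ae_notMem.2 ?_
  filter_upwards [h4] with p hp ⟨hpl, hpU⟩
  have := hp hpl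
  rw [indicator_of_mem (by exact hpU), ENNReal.ofReal_eq_zero] at this
  exact this.not_gt (hpos _ hpU)

/-- If the potential on `U` is dominated by that on `S` and both agree at `x`, then a process
started at `x` spends no time off `U` before it leaves `S`. -/
theorem IsDiffusion.ae_time_before_exit_eq_zero {D : ContinuousFamily d Ω} (hD : D.IsDiffusion)
    {r : ℝ} {f : EuclideanSpace ℝ (Fin d) → ℝ} (hf : Measurable f)
    {S U : Set (EuclideanSpace ℝ (Fin d))} (hS : IsClosed S) (hne : S.Nonempty)
    (hU : MeasurableSet U)
    (hpos : ∀ y ∈ S, 0 < f y) (hle : ∀ y, D.potentialOn r f U y ≤ D.potentialOn r f S y)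
    {x : EuclideanSpace ℝ (Fin d)} (heq : D.potentialOn r f S x = D.potentialOn r f U x)
    (hfin : D.potentialOn r f S x ≠ ⊤) :
    ∀ᵐ ω ∂D.P x, timeMeasure {t : ℝ≥0 | (t : WithTop ℝ≥0) ≤ D.hit Sᶜ ω ∧ D.X t ω ∉ U} = 0 := by
  set a : EuclideanSpace ℝ (Fin d) → ℝ≥0∞ := fun y => ENNReal.ofReal (f y)
  have hma : Measurable a := hf.ennreal_ofReal
  have hmX := D.measurable_uncurry
  have hmS := hma.indicator hS.measurableSet
  have hmU := hma.indicator hU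
  -- The exit set `Sᶜ` is open, while the splitting needs closed sets; `Sᶜ` is exhausted by the
  -- closed sets at distance at least `1 / (n + 1)` from `S`.
  set K : ℕ → Set (EuclideanSpace ℝ (Fin d)) :=
    fun n => {y | 1 / ((n : ℝ) + 1) ≤ Metric.infDist y S}
  have hKc : ∀ n, IsClosed (K n) := fun n =>
    isClosed_le continuous_const (Metric.continuous_infDist_pt S)
  have hKmono : Monotone K := fun m n hmn y hy => by
    have : 1 / ((n : ℝ) + 1) ≤ 1 / ((m : ℝ) + 1) := by gcongr
    exact this.trans hy
  have hKsub : ∀ n, K n ⊆ Sᶜ := fun n y hy hyS => by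
    have h0 : 1 / ((n : ℝ) + 1) ≤ 0 := Metric.infDist_zero_of_mem hyS ▸ hy
    have : 0 < 1 / ((n : ℝ) + 1) := by positivity
    linarith
  have hKcover : Sᶜ ⊆ ⋃ n, K n := fun y hy => by
    have h0 : 0 < Metric.infDist y S := (hS.notMem_iff_infDist_pos hne).1 hy
    obtain ⟨n, hn⟩ := exists_nat_one_div_lt h0
    exact mem_iUnion.2 ⟨n, hn.le⟩
  set A : ℕ → Set (ℝ≥0 × Ω) := fun n => {p | (p.1 : WithTop ℝ≥0) < D.hit (K n) p.2}
  have hAm : ∀ n, MeasurableSet (A n) := fun n =>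
    measurableSet_lt measurable_fst.withTop_coe ((D.measurable_hit (hKc n)).comp measurable_snd)
  have hAanti : Antitone A := fun m n hmn p hp =>
    lt_of_lt_of_le hp (D.hit_anti (hKmono hmn) p.2)
  have hstep : ∀ n, ∫⁻ p in A n, S.indicator a (D.X p.1 p.2) ∂D.pathMeasure r x ≤
      ∫⁻ p in A n, U.indicator a (D.X p.1 p.2) ∂D.pathMeasure r x := by
    intro n
    have h1 := hD.lintegral_green_eq_add r (hKc n) x hmS
    have h2 := hD.lintegral_green_eq_add r (hKc n) x hmU
    have hb : ∫⁻ ω in {ω | D.hit (K n) ω ≠ ⊤},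
        ENNReal.ofReal (Real.exp (-r * (D.hit (K n) ω).untopA)) *
          ∫⁻ y, U.indicator a y ∂D.green r (stoppedValue D.X (D.hit (K n)) ω) ∂D.P x ≤
        ∫⁻ ω in {ω | D.hit (K n) ω ≠ ⊤},
        ENNReal.ofReal (Real.exp (-r * (D.hit (K n) ω).untopA)) *
          ∫⁻ y, S.indicator a y ∂D.green r (stoppedValue D.X (D.hit (K n)) ω) ∂D.P x :=
      lintegral_mono fun ω => mul_le_mul_right (hle _) _
    -- The `S`-potential collected after hitting `K n` is finite, being a summand of the potential
    -- at `x`, so it can be cancelled.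
    refine ENNReal.le_of_add_le_add_right
      (ne_top_of_le_ne_top hfin (h1.symm ▸ le_add_self : _ ≤ D.potentialOn r f S x)) ?_
    rw [← h1]
    exact (heq.trans h2).le.trans (add_le_add_right hb _)
  set B := ⋂ n, A n with hB
  have hBm : MeasurableSet B := MeasurableSet.iInter hAm
  have hBfin : ∫⁻ p, S.indicator a (D.X p.1 p.2) ∂D.pathMeasure r x ≠ ⊤ := by
    rw [← D.lintegral_green r x hmS]
    exact hfin
  have hUfin : ∫⁻ p, U.indicator a (D.X p.1 p.2) ∂D.pathMeasure r x ≠ ⊤ := by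
    rw [← D.lintegral_green r x hmU]
    exact ne_of_eq_of_ne heq.symm hfin
  have hlim : ∀ {F : ℝ≥0 × Ω → ℝ≥0∞}, ∫⁻ p, F p ∂D.pathMeasure r x ≠ ⊤ →
      Tendsto (fun n => ∫⁻ p in A n, F p ∂D.pathMeasure r x) atTop
        (𝓝 (∫⁻ p in B, F p ∂D.pathMeasure r x)) := by
    intro F hF
    -- This is continuity from above for the measure with density `F`, finite by `hF`.
    have := tendsto_measure_iInter_atTop (μ := (D.pathMeasure r x).withDensity F)
      (fun n => (hAm n).nullMeasurableSet) hAanti ⟨0, by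
        rw [withDensity_apply _ (hAm 0)]
        exact ne_top_of_le_ne_top hF (setLIntegral_le_lintegral _ _)⟩
    rw [← hB, withDensity_apply _ hBm] at this
    simpa only [Function.comp_def, withDensity_apply _ (hAm _)] using this
  have hBle := le_of_tendsto_of_tendsto' (hlim hBfin) (hlim hUfin) hstep
  have hBhit : ∀ p ∈ B, (p.1 : WithTop ℝ≥0) ≤ D.hit Sᶜ p.2 := fun p hp =>
    D.le_hit_of_forall_le hKcover fun n => (mem_iInter.1 hp n).le
  have hBof : ∀ p : ℝ≥0 × Ω, (p.1 : WithTop ℝ≥0) < D.hit Sᶜ p.2 → p ∈ B := fun p hp =>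
    mem_iInter.2 fun n => lt_of_lt_of_le hp (D.hit_anti (hKsub n) p.2)
  -- A point of `B` off `S` can only occur at the exit time itself, one instant per path.
  have hBS : ∀ᵐ p ∂D.pathMeasure r x, p ∈ B → D.X p.1 p.2 ∈ S := by
    have hnull : D.pathMeasure r x (B ∩ (fun p => D.X p.1 p.2) ⁻¹' Sᶜ) = 0 := by
      rw [D.pathMeasure_eq_zero_iff r x (hBm.inter (hmX hS.measurableSet.compl))]
      refine ae_of_all _ fun ω => Set.Subsingleton.measure_zero ?_ _
      have h : ∀ t : ℝ≥0, (t, ω) ∈ B ∩ (fun p => D.X p.1 p.2) ⁻¹' Sᶜ →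
          (t : WithTop ℝ≥0) = D.hit Sᶜ ω := fun t ht =>
        (hBhit _ ht.1).antisymm (hittingAfter_le_of_mem zero_le ht.2)
      intro s hs t ht
      exact WithTop.coe_injective ((h s hs).trans (h t ht).symm)
    filter_upwards [measure_eq_zero_iff_ae_notMem.1 hnull] with p hp hpB
    by_contra hpS
    exact hp ⟨hpB, hpS⟩
  have hmSdX : Measurable fun p : ℝ≥0 × Ω => (S \ U).indicator a (D.X p.1 p.2) :=
    (hma.indicator (hS.measurableSet.diff hU)).comp hmX
  have hsplit : ∫⁻ p in B, S.indicator a (D.X p.1 p.2) ∂D.pathMeasure r x =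
      ∫⁻ p in B, (S \ U).indicator a (D.X p.1 p.2) ∂D.pathMeasure r x +
        ∫⁻ p in B, (S ∩ U).indicator a (D.X p.1 p.2) ∂D.pathMeasure r x := by
    rw [← lintegral_add_left hmSdX]
    congr 1 with p
    by_cases h1 : D.X p.1 p.2 ∈ S <;> by_cases h2 : D.X p.1 p.2 ∈ U <;> simp [h1, h2]
  have hUeq : ∫⁻ p in B, U.indicator a (D.X p.1 p.2) ∂D.pathMeasure r x =
      ∫⁻ p in B, (S ∩ U).indicator a (D.X p.1 p.2) ∂D.pathMeasure r x := by
    refine setLIntegral_congr_fun_ae hBm ?_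
    filter_upwards [hBS] with p hp hpB
    have h1 := hp hpB
    by_cases h2 : D.X p.1 p.2 ∈ U <;> simp [h1, h2]
  -- The part collected on `S ∩ U` is common to both sides of `hBle` and finite, so it cancels.
  have hzero : ∫⁻ p in B, (S \ U).indicator a (D.X p.1 p.2) ∂D.pathMeasure r x = 0 := by
    rw [hsplit, hUeq] at hBle
    refine nonpos_iff_eq_zero.1 (ENNReal.le_of_add_le_add_right (c := 0) ?_
      (hBle.trans (zero_add _).ge))
    rw [← hUeq]
    exact ne_top_of_le_ne_top hUfin (setLIntegral_le_lintegral _ _)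
  rw [setLIntegral_eq_zero_iff hBm hmSdX] at hzero
  have hnull : D.pathMeasure r x (B ∩ (fun p => D.X p.1 p.2) ⁻¹' Uᶜ) = 0 := by
    refine measure_eq_zero_iff_ae_notMem.2 ?_
    filter_upwards [hzero, hBS] with p hp hpS ⟨hpB, hpU⟩
    have := hp hpB
    rw [indicator_of_mem (show D.X p.1 p.2 ∈ S \ U from ⟨hpS hpB, hpU⟩),
      ENNReal.ofReal_eq_zero] at this
    exact this.not_gt (hpos _ (hpS hpB))
  refine ae_timeMeasure_le_eq_zero ?_
  filter_upwards [(D.pathMeasure_eq_zero_iff r x (hBm.inter (hmX hU.compl))).1 hnull] with ω hω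
  refine measure_mono_null (fun t ht => ?_) hω
  exact ⟨hBof (t, ω) ht.1, ht.2⟩

end ContinuousFamily

/-! ### Optimality and uniqueness of the stopping set -/

theorem theorem2p4 {d : ℕ} {Ω : Type*} [MeasurableSpace Ω]
    (D : ContinuousFamily d Ω) (hD : D.IsDiffusion)
    (r : ℝ) (hr : 0 < r)
    (g : EuclideanSpace ℝ (Fin d) → ℝ) (hg : Continuous g) (hg0 : ∀ x, 0 ≤ g x)
    (f : EuclideanSpace ℝ (Fin d) → ℝ) (hf : Continuous f)
    (hfint : ∀ x, Integrable f (D.green r x))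
    (hfg : ∀ x, g x = ∫ y, f y ∂D.green r x)
    (hV : ∀ x, D.value r g x = ENNReal.ofReal (∫ y in D.stoppingSet r g, f y ∂D.green r x))
    (𝕌 : Set (Set (EuclideanSpace ℝ (Fin d))))
    (h𝕌 : ∀ U ∈ 𝕌, U.Nonempty ∧ IsClosed U)
    (hS : D.stoppingSet r g ∈ 𝕌)
    (ha : ∀ U ∈ 𝕌, ∀ y ∈ U, 0 < f y)
    (hb1 : ∀ U ∈ 𝕌, ∀ U' ∈ 𝕌,
      (∀ x ∈ U ∩ U', ∀ᵐ ω ∂D.P x,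
        timeMeasure {t : ℝ≥0 | (t : WithTop ℝ≥0) ≤ D.hit Uᶜ ω ∧ D.X t ω ∉ U'} = 0) → U ⊆ U')
    (hb2 : ∀ U ∈ 𝕌, ∀ U' ∈ 𝕌,
      (∀ x ∈ Uᶜ, ∀ᵐ ω ∂D.P x,
        timeMeasure {t : ℝ≥0 | (t : WithTop ℝ≥0) ≤ D.hit U ω ∧ D.X t ω ∈ U'} = 0) → U' ⊆ U) :
    D.IsOptimal r g (D.hit (D.stoppingSet r g)) ∧
    ∀ U ∈ 𝕌, (∀ x ∈ frontier U, ∫ y in Uᶜ, f y ∂D.green r x = 0) ↔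
      U = D.stoppingSet r g := by
  have hclosed := (h𝕌 _ hS).2
  have hpot : ∀ U ∈ 𝕌, ∀ x, D.potentialOn r f U x =
      ENNReal.ofReal (∫ y in U, f y ∂D.green r x) := fun U hU x =>
    D.potentialOn_eq_ofReal r (h𝕌 U hU).2.measurableSet (fun y hy => (ha U hU y hy).le) (hfint x)
  have hVS : ∀ x, D.potentialOn r f (D.stoppingSet r g) x = D.value r g x := fun x => by
    rw [hpot _ hS, hV]
  have hreward : ∀ U, IsClosed U → ∀ x,
      g x = ∫ y in U, f y ∂D.green r x + ∫ y in Uᶜ, f y ∂D.green r x := fun U hU x => by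
    rw [integral_add_compl hU.measurableSet (hfint x), hfg]
  have hSg : ∀ y ∈ D.stoppingSet r g,
      D.potentialOn r f (D.stoppingSet r g) y = ENNReal.ofReal (g y) := fun y hy =>
    (hVS y).trans hy
  refine ⟨⟨D.isStoppingTime_hit hclosed, fun x => ?_⟩, fun U hU => ⟨fun hfr => ?_, ?_⟩⟩
  · refine le_antisymm (D.payoff_hit_le_value r g hclosed x) ?_
    rw [← hVS]
    exact hD.potentialOn_le_payoff hf.measurable hclosed hSg x
  · have hUc := (h𝕌 U hU).2
    have hUg : ∀ y ∈ U, D.potentialOn r f U y = ENNReal.ofReal (g y) := fun y hy => by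
      rw [hpot U hU, hreward U hUc y,
        hD.setIntegral_compl_eq_zero hf.measurable hfint hUc.measurableSet hfr hy, add_zero]
    have hle : ∀ y, D.potentialOn r f U y ≤ D.potentialOn r f (D.stoppingSet r g) y := fun y => by
      rw [hVS]
      exact (hD.potentialOn_le_payoff hf.measurable hUc hUg y).trans
        (D.payoff_hit_le_value r g hUc y)
    have hfin : ∀ y, D.potentialOn r f (D.stoppingSet r g) y ≠ ⊤ := fun y => by
      rw [hpot _ hS]
      exact ENNReal.ofReal_ne_top
    have hSU : D.stoppingSet r g ⊆ U := hb1 _ hS U hU fun x hx =>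
      hD.ae_time_before_exit_eq_zero hf.measurable hclosed (h𝕌 _ hS).1 hUc.measurableSet
        (ha _ hS) hle ((hSg x hx.1).trans (hUg x hx.2).symm) (hfin x)
    -- The inclusion `hSU` is needed first: it puts `S` inside `U`, where the potential on `U` is
    -- known to equal `g`.
    refine Subset.antisymm (hb2 _ hS U hU fun x _ => ?_) hSU
    exact hD.ae_time_before_hit_eq_zero hf.measurable hclosed hUc.measurableSet (ha U hU)
      (fun y hy => (hUg y (hSU hy)).trans (hSg y hy).symm) (hle x) (hfin x)
  · rintro rfl x hx
    have hxS := hclosed.frontier_subset hx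
    -- On the frontier, which lies in the closed set `S`, `V = g`; both sides are nonnegative, so
    -- `ENNReal.ofReal` can be removed and the remaining integral over `Sᶜ` is zero.
    have h1 : ENNReal.ofReal (∫ y in D.stoppingSet r g, f y ∂D.green r x) =
        ENNReal.ofReal (g x) := (hV x).symm.trans hxS
    have h2 : 0 ≤ ∫ y in D.stoppingSet r g, f y ∂D.green r x :=
      setIntegral_nonneg hclosed.measurableSet fun y hy => (ha _ hS y hy).le
    rw [ENNReal.ofReal_eq_ofReal_iff h2 (hg0 x)] at h1
    linarith [hreward _ hclosed x]
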